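/- Let $n\ge 2$ and $0<\mu\le 1$. Consider the game in which each of $n$ boxes simultaneously chooses a Borel probability distribution on $[0,1]$ with mean $\mu$; the rewards $X_1,\dots,X_n$ are then drawn independently from the chosen distributions, the box with the highest realization is selected, ties being broken uniformly at random among the boxes with the highest realization, and the payoff of a box is the probability that it is selected. A symmetric equilibrium is a distribution $F$ such that all boxes playing $F$ is a (pure-strategy) Nash equilibrium of this game. (i) If $\mu\ge 1/n$, there is exactly one $a\in[0,1]$ such that $a=\mu-\mu(1-a)^n$ and, in case $\mu>1/n$, $a>0$. With this $a$ and $s=n\mu(1-a)^{n-1}$ one has $s\le 1$, and there is exactly one symmetric equilibrium: the distribution $F^*$ on $[0,s]\cup\{1\}$ with an atom $\Pr(X=1)=a$ and $$F^*(x)=\Pr(X\le x)=(1-a)\Big(\frac{x}{s}\Big)^{1/(n-1)}\qquad\text{for } x\in[0,s]$$ (for $\mu=1$ we have $a=1$, $s=0$, and $F^*$ is the point mass at $1$). (ii) If $\mu<1/n$, there is exactly one symmetric equilibrium: the distribution supported on $[0,n\mu]$ with $$F^*(x)=\Big(\frac{x}{n\mu}\Big)^{1/(n-1)}\qquad\text{for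 } x\in[0,n\mu].$$ -/

import Mathlib

open MeasureTheory

/-- The pure strategies `M(μ)` of a box: the Borel probability distributions supported on
`[0,1]` with mean `μ`. -/
def strategySet (μ : ℝ) : Set (ProbabilityMeasure ℝ) :=
  {F | (F : Measure ℝ) (Set.Icc 0 1)ᶜ = 0 ∧ ∫ x, x ∂(F : Measure ℝ) = μ}

/-- The probability that box `i` is selected when the realized rewards are `x`: the highest
realization wins, and ties are broken uniformly. -/
noncomputable def winProb {n : ℕ} (i : Fin n) (x : Fin n → ℝ) : ℝ :=
  if ∀ j, x j ≤ x i then 1 / ((Finset.univ.filter fun j => x j = x i).card : ℝ) else 0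

/-- The payoff of box `i` when the boxes play the distributions `F 0, …, F (n - 1)`: the
probability that it is selected, the rewards being independent. -/
noncomputable def payoff {n : ℕ} (F : Fin n → ProbabilityMeasure ℝ) (i : Fin n) : ℝ :=
  ∫ x, winProb i x ∂(Measure.pi fun j => (F j : Measure ℝ))

/-- `F` is a Nash equilibrium of the frictionless game: all boxes play feasible distributions,
and no box gains by deviating alone to another feasible distribution. -/
def IsEquilibrium {n : ℕ} (μ : ℝ) (F : Fin n → ProbabilityMeasure ℝ) : Prop :=
  (∀ i, F i ∈ strategySet μ) ∧
    ∀ i, ∀ G ∈ strategySet μ, payoff (Function.update F i G) i ≤ payoff F i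

/-- It is a (symmetric) equilibrium of the game with `n` boxes that each box plays `F`. -/
def IsSymmetricEquilibrium (n : ℕ) (μ : ℝ) (F : ProbabilityMeasure ℝ) : Prop :=
  IsEquilibrium μ (fun _ : Fin n => F)

/-- `a` is the admissible solution in `[0,1]` of `a = μ - μ (1 - a) ^ n`. Since `a = 0` always
solves the equation, `a` is required to be positive unless `μ = 1 / n`. -/
def IsAtomWeight (n : ℕ) (μ a : ℝ) : Prop :=
  0 ≤ a ∧ a ≤ 1 ∧ a = μ - μ * (1 - a) ^ n ∧ (1 / (n : ℝ) < μ → 0 < a)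

/-!
Let `n = m + 1` boxes play the game. If the `m` opponents of a box all draw from `ν`, with
`c x = ν (-∞, x]` and `d x = ν (-∞, x)`, then a box showing the reward `x` is selected with
probability `u x = (1 / n) ∑ i ≤ m, c x ^ i * d x ^ (m - i)` (`interimPayoff_eq`). By Fubini a
deviation to `G` pays `∫ u ∂G`, and by symmetry not deviating pays `1 / n`, so that an equilibrium
is a feasible `ν` with `∫ u ∂G ≤ 1 / n` for every feasible `G` (`isSymmetricEquilibrium_iff`).

*Existence.* The distribution `(1 - a) • law (s * U ^ m) + a • δ₁`, with `U` uniform on `[0,1]`, has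
mean `μ` and satisfies `u x ≤ x / (n * μ)` on `[0,1]`: on `[0,s]` there is equality since
`c x ^ m` is linear there, and at `1` the inequality is `μ * ∑ i < n, (1 - a) ^ i ≤ 1`, which is
what the equation for `a` says. Integrating against `G` gives `∫ u ∂G ≤ 1 / n`. The case
`μ < 1 / n` is the case `a = 0`, the only admissible weight there.

*Uniqueness.* Let `ν` be an equilibrium and `μ < 1`. Two-point deviations show that the concave
envelope of `u` at `μ` is at most `1 / n`, so `u` lies below an affine function `α + β * x` with
value `1 / n` at `μ`, and agrees with it `ν`-almost everywhere
(`exists_line_of_isSymmetricEquilibrium`). An atom in `[0,1)` would make `u` jump over the line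
immediately to its right, so there is none and `u = c ^ m` on `[0,1)`. Whenever mass is left in
`(x, 1)`, the value `c x ^ m` is attained on the line at some point `y ≥ x`
(`exists_touching_point`). To the left of all mass this gives `α = 0`, hence `β = 1 / (n * μ)`; for
other `x` it gives `n * μ * c x ^ m = min x (n * μ * (1 - ν {1}) ^ m)`. Comparing `u 1` with `β`
shows that `ν {1}` is an admissible atom weight, and the admissible weight is unique. So `c`, and
with it `ν`, is determined by `μ`. For `μ = 1` the point mass at `1` is the only feasible choice.
-/

/-! ### The winning probability -/

/-- The probability that a box with realized reward `x` is selected when the rewards of its `m`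
opponents are `z`. -/
noncomputable def tieShare {m : ℕ} (x : ℝ) (z : Fin m → ℝ) : ℝ :=
  if ∀ j, z j ≤ x then 1 / ((Finset.univ.filter fun j => z j = x).card + 1 : ℝ) else 0

lemma winProb_insertNth {m : ℕ} (i : Fin (m + 1)) (x : ℝ) (z : Fin m → ℝ) :
    winProb i (i.insertNth x z : Fin (m + 1) → ℝ) = tieShare x z := by
  have hc : ((Finset.univ.filter fun j => (i.insertNth x z : Fin (m + 1) → ℝ) j = x).card : ℝ) =
      (Finset.univ.filter fun j => z j = x).card + 1 := by
    simp only [Finset.card_filter, Fin.sum_univ_succAbove _ i]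
    simp [add_comm]
  unfold winProb tieShare
  simp [Fin.forall_iff_succAbove i, hc]

lemma winProb_nonneg {n : ℕ} (i : Fin n) (y : Fin n → ℝ) : 0 ≤ winProb i y := by
  unfold winProb
  split_ifs <;> positivity

lemma winProb_le_one {n : ℕ} (i : Fin n) (y : Fin n → ℝ) : winProb i y ≤ 1 := by
  unfold winProb
  split_ifs
  · have : 1 ≤ (Finset.univ.filter fun j => y j = y i).card :=
      Finset.card_pos.2 ⟨i, by simp⟩
    rw [div_le_one (by positivity)]
    exact_mod_cast this
  · norm_num

lemma measurable_winProb {n : ℕ} (i : Fin n) : Measurable (winProb i) := by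
  have hc : (fun y : Fin n → ℝ => ((Finset.univ.filter fun j => y j = y i).card : ℝ)) =
      fun y => ∑ j, if y j = y i then (1 : ℝ) else 0 := by
    funext y
    simp
  unfold winProb
  refine Measurable.ite ?_ ?_ measurable_const
  · simp only [Set.ofPred_forall]
    exact MeasurableSet.iInter fun j => measurableSet_le (by fun_prop) (by fun_prop)
  · refine Measurable.div measurable_const ?_
    rw [hc]
    exact Finset.measurable_sum _ fun j _ => Measurable.ite
      (measurableSet_eq_fun (by fun_prop) (by fun_prop)) measurable_const measurable_const

lemma winProb_of_forall_le {n : ℕ} {y : Fin n → ℝ} {k : Fin n} (hk : ∀ j, y j ≤ y k) (i : Fin n) :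
    winProb i y =
      if y i = y k then 1 / ((Finset.univ.filter fun j => y j = y k).card : ℝ) else 0 := by
  unfold winProb
  by_cases hi : y i = y k
  · simp [hi, hk]
  · rw [if_neg hi, if_neg]
    intro h
    exact hi (le_antisymm (hk i) (h k))

lemma sum_winProb {n : ℕ} [Nonempty (Fin n)] (y : Fin n → ℝ) : ∑ i, winProb i y = 1 := by
  obtain ⟨k, hk⟩ := Finite.exists_max y
  have hpos : (0 : ℝ) < ((Finset.univ.filter fun j => y j = y k).card : ℝ) := by
    exact_mod_cast Finset.card_pos.2 ⟨k, by simp⟩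
  simp only [winProb_of_forall_le hk]
  rw [← Finset.sum_filter, Finset.sum_const, nsmul_eq_mul]
  field_simp

/-- Summing over all boxes the probability of being selected with reward `x` gives the indicator
of the event that the highest reward equals `x`. -/
lemma sum_winProb_mul_indicator {n : ℕ} [Nonempty (Fin n)] (y : Fin n → ℝ) (x : ℝ) :
    ∑ i, winProb i y * ({x} : Set ℝ).indicator 1 (y i) =
      (Set.univ.pi fun _ => Set.Iic x).indicator 1 y -
        (Set.univ.pi fun _ => Set.Iio x).indicator 1 y := by
  obtain ⟨k, hk⟩ := Finite.exists_max y
  rcases lt_trichotomy (y k) x with h | rfl | h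
  · have hlt : ∀ j, y j < x := fun j => (hk j).trans_lt h
    rw [Set.indicator_of_mem (s := Set.univ.pi fun _ => Set.Iic x) fun j _ => (hlt j).le,
      Set.indicator_of_mem (s := Set.univ.pi fun _ => Set.Iio x) fun j _ => hlt j]
    simp [fun j => (hlt j).ne]
  · rw [Set.indicator_of_mem (s := Set.univ.pi fun _ => Set.Iic (y k)) fun j _ => hk j,
      Set.indicator_of_notMem (s := Set.univ.pi fun _ => Set.Iio (y k)) fun h =>
        (show y k < y k from h k trivial).false,
      Pi.one_apply, sub_zero, ← sum_winProb y]
    refine Finset.sum_congr rfl fun i _ => ?_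
    by_cases hi : y i = y k <;> simp [hi, winProb_of_forall_le hk]
  · rw [Set.indicator_of_notMem (s := Set.univ.pi fun _ => Set.Iic x) fun h' =>
        h.not_ge (h' k trivial),
      Set.indicator_of_notMem (s := Set.univ.pi fun _ => Set.Iio x) fun h' =>
        h.not_gt (h' k trivial), sub_zero]
    refine Finset.sum_eq_zero fun i _ => ?_
    by_cases hi : y i = x
    · simp [hi, h.ne, winProb_of_forall_le hk]
    · simp [hi]

/-! ### The interim payoff -/

section

/-- Fubini for a product measure, with the `i`-th coordinate integrated last. -/
lemma integral_pi_insertNth {m : ℕ} (ν : Fin (m + 1) → Measure ℝ)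
    [∀ j, IsProbabilityMeasure (ν j)] (i : Fin (m + 1)) {g : (Fin (m + 1) → ℝ) → ℝ}
    (hg : Integrable g (Measure.pi ν)) :
    ∫ y, g y ∂Measure.pi ν =
      ∫ x, ∫ z, g (i.insertNth x z : Fin (m + 1) → ℝ)
        ∂Measure.pi (fun j => ν (i.succAbove j)) ∂ν i := by
  have h := (measurePreserving_piFinSuccAbove ν i).symm
  rw [← h.integral_comp (MeasurableEquiv.measurableEmbedding _) g, integral_prod]
  · rfl
  · exact (h.integrable_comp_emb (MeasurableEquiv.measurableEmbedding _)).2 hg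

/-- The probability that a box with realized reward `x` is selected when its `m` opponents draw
their rewards independently from `ν`. -/
noncomputable def interimPayoff (m : ℕ) (ν : Measure ℝ) (x : ℝ) : ℝ :=
  ∫ z, tieShare x z ∂Measure.pi fun _ : Fin m => ν

lemma integrable_winProb {n : ℕ} (P : Measure (Fin n → ℝ)) [IsFiniteMeasure P] (i : Fin n) :
    Integrable (winProb i) P := by
  refine Integrable.of_bound (measurable_winProb i).aestronglyMeasurable 1 (ae_of_all _ fun y => ?_)
  rw [Real.norm_eq_abs, abs_of_nonneg (winProb_nonneg i y)]
  exact winProb_le_one i y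

lemma payoff_eq_integral_interimPayoff {m : ℕ} (F : Fin (m + 1) → ProbabilityMeasure ℝ)
    (G : ProbabilityMeasure ℝ) (i : Fin (m + 1)) (hF : ∀ j, F (i.succAbove j) = G) :
    payoff F i = ∫ x, interimPayoff m (G : Measure ℝ) x ∂(F i : Measure ℝ) := by
  unfold payoff interimPayoff
  rw [integral_pi_insertNth _ i (integrable_winProb _ i)]
  simp only [winProb_insertNth, hF]

/-- Exactly one box is selected, so each of `m + 1` identical boxes is selected with probability
`1 / (m + 1)`. -/
lemma integral_interimPayoff_self {m : ℕ} (F : ProbabilityMeasure ℝ) :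
    ∫ x, interimPayoff m (F : Measure ℝ) x ∂(F : Measure ℝ) = 1 / (m + 1) := by
  have h1 : ∑ i : Fin (m + 1), payoff (fun _ => F) i = 1 := by
    unfold payoff
    rw [← integral_finsetSum _ fun i _ => integrable_winProb _ i]
    simp [sum_winProb]
  simp only [fun i => payoff_eq_integral_interimPayoff (m := m) (fun _ => F) F i fun _ => rfl]
    at h1
  simp at h1
  field_simp
  linarith

lemma tieShare_nonneg {m : ℕ} (x : ℝ) (z : Fin m → ℝ) : 0 ≤ tieShare x z := by
  rw [← winProb_insertNth 0]; exact winProb_nonneg _ _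

lemma tieShare_le_one {m : ℕ} (x : ℝ) (z : Fin m → ℝ) : tieShare x z ≤ 1 := by
  rw [← winProb_insertNth 0]; exact winProb_le_one _ _

lemma measurable_tieShare {m : ℕ} : Measurable fun p : ℝ × (Fin m → ℝ) => tieShare p.1 p.2 := by
  have h := (measurable_winProb (0 : Fin (m + 1))).comp
    (MeasurableEquiv.piFinSuccAbove (fun _ => ℝ) 0).symm.measurable
  convert h using 2 with p
  exact (winProb_insertNth 0 p.1 p.2).symm

lemma integrable_tieShare {m : ℕ} (P : Measure (Fin m → ℝ)) [IsFiniteMeasure P] (x : ℝ) :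
    Integrable (tieShare x) P := by
  refine Integrable.of_bound
    (measurable_tieShare.comp measurable_prodMk_left).aestronglyMeasurable 1
    (ae_of_all _ fun y => ?_)
  rw [Real.norm_eq_abs, abs_of_nonneg (tieShare_nonneg x y)]
  exact tieShare_le_one x y

variable {m : ℕ} {ν : Measure ℝ}

lemma interimPayoff_nonneg (x : ℝ) : 0 ≤ interimPayoff m ν x :=
  integral_nonneg fun _ => tieShare_nonneg _ _

variable [IsProbabilityMeasure ν]

lemma measurable_interimPayoff : Measurable (interimPayoff m ν) :=
  (measurable_tieShare.stronglyMeasurable.integral_prod_right).measurable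

lemma interimPayoff_le_one (x : ℝ) : interimPayoff m ν x ≤ 1 := by
  refine (integral_mono (integrable_tieShare _ x) (integrable_const 1)
    fun z => tieShare_le_one x z).trans ?_
  simp

lemma integrable_interimPayoff (P : Measure ℝ) [IsFiniteMeasure P] :
    Integrable (interimPayoff m ν) P := by
  refine Integrable.of_bound measurable_interimPayoff.aestronglyMeasurable 1
    (ae_of_all _ fun x => ?_)
  rw [Real.norm_eq_abs, abs_of_nonneg (interimPayoff_nonneg x)]
  exact interimPayoff_le_one x

lemma integral_indicator_forall_mem {n : ℕ} {A : Set ℝ} (hA : MeasurableSet A) :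
    ∫ y, (Set.univ.pi fun _ : Fin n => A).indicator 1 y ∂(Measure.pi fun _ : Fin n => ν) =
      ν.real A ^ n := by
  rw [integral_indicator_one (MeasurableSet.univ_pi fun _ => hA)]
  simp [measureReal_def, Measure.pi_pi]

lemma pow_measureReal_Iio_le_interimPayoff (x : ℝ) :
    ν.real (Set.Iio x) ^ m ≤ interimPayoff m ν x := by
  rw [← integral_indicator_forall_mem measurableSet_Iio]
  refine integral_mono ((integrable_const 1).indicator
    (MeasurableSet.univ_pi fun _ => measurableSet_Iio)) (integrable_tieShare _ x) fun z => ?_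
  refine Set.indicator_le' (fun z hz => ?_) (fun z _ => tieShare_nonneg x z) z
  simp only [Set.mem_univ_pi, Set.mem_Iio] at hz
  have : (Finset.univ.filter fun j => z j = x) = ∅ := by
    simp [fun j => (hz j).ne]
  simp [tieShare, fun j => (hz j).le, this]

lemma interimPayoff_le_pow_measureReal_Iic (x : ℝ) :
    interimPayoff m ν x ≤ ν.real (Set.Iic x) ^ m := by
  rw [← integral_indicator_forall_mem measurableSet_Iic]
  refine integral_mono (integrable_tieShare _ x) ((integrable_const 1).indicator
    (MeasurableSet.univ_pi fun _ => measurableSet_Iic)) fun z => ?_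
  by_cases hz : ∀ j, z j ≤ x
  · rw [Set.indicator_of_mem (s := Set.univ.pi fun _ => Set.Iic x) fun j _ => hz j]
    exact tieShare_le_one x z
  · simp only [tieShare, if_neg hz]
    exact Set.indicator_nonneg (by simp) z

/-- Both sides are the probability that the highest of `m + 1` independent draws from `ν` equals
`x`. The case of an atom at `x` of `interimPayoff_eq` follows without enumerating ties. -/
lemma measureReal_singleton_mul_interimPayoff (x : ℝ) :
    (m + 1) * (ν.real {x} * interimPayoff m ν x) =
      ν.real (Set.Iic x) ^ (m + 1) - ν.real (Set.Iio x) ^ (m + 1) := by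
  have hint : ∀ i : Fin (m + 1), Integrable
      (fun y : Fin (m + 1) → ℝ => winProb i y * ({x} : Set ℝ).indicator 1 (y i))
      (Measure.pi fun _ => ν) := by
    intro i
    have h := (integrable_winProb (Measure.pi fun _ : Fin (m + 1) => ν) i).indicator
      (measurable_pi_apply i (measurableSet_singleton x))
    refine h.congr (ae_of_all _ fun y => ?_)
    by_cases hy : y i = x <;> simp [hy]
  have hval : ∀ i : Fin (m + 1), ∫ y : Fin (m + 1) → ℝ,
      winProb i y * ({x} : Set ℝ).indicator 1 (y i) ∂(Measure.pi fun _ => ν) =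
        ν.real {x} * interimPayoff m ν x := by
    intro i
    rw [integral_pi_insertNth _ i (hint i)]
    simp only [winProb_insertNth, Fin.insertNth_apply_same, integral_mul_const]
    rw [integral_congr_ae (g := ({x} : Set ℝ).indicator fun _ => interimPayoff m ν x)
      (ae_of_all _ fun t => ?_), integral_indicator_const _ (measurableSet_singleton x),
      smul_eq_mul]
    by_cases ht : t = x
    · subst ht
      simp [interimPayoff]
    · simp [ht]
  calc (m + 1) * (ν.real {x} * interimPayoff m ν x)
      = ∑ i : Fin (m + 1), ∫ y : Fin (m + 1) → ℝ,
          winProb i y * ({x} : Set ℝ).indicator 1 (y i) ∂(Measure.pi fun _ => ν) := by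
        simp only [hval]
        simp
    _ = _ := by
        rw [← integral_finsetSum _ fun i _ => hint i]
        simp only [sum_winProb_mul_indicator]
        rw [integral_sub, integral_indicator_forall_mem measurableSet_Iic,
          integral_indicator_forall_mem measurableSet_Iio]
        · exact (integrable_const 1).indicator (MeasurableSet.univ_pi fun _ => measurableSet_Iic)
        · exact (integrable_const 1).indicator (MeasurableSet.univ_pi fun _ => measurableSet_Iio)

lemma measureReal_Iic_eq_add (x : ℝ) : ν.real (Set.Iic x) = ν.real (Set.Iio x) + ν.real {x} := by
  rw [← measureReal_union (by simp) (measurableSet_singleton x), Set.Iio_union_right]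

/-- Closed form of the interim payoff, valid whether or not `ν` has an atom at `x`. -/
lemma interimPayoff_eq (x : ℝ) :
    (m + 1) * interimPayoff m ν x =
      ∑ i ∈ Finset.range (m + 1), ν.real (Set.Iic x) ^ i * ν.real (Set.Iio x) ^ (m - i) := by
  have hcd := measureReal_Iic_eq_add (ν := ν) x
  rcases eq_or_ne (ν.real {x}) 0 with h0 | h0
  · have h1 := pow_measureReal_Iio_le_interimPayoff (m := m) (ν := ν) x
    have h2 := interimPayoff_le_pow_measureReal_Iic (m := m) (ν := ν) x
    rw [h0, add_zero] at hcd
    rw [hcd] at h2 ⊢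
    rw [le_antisymm h2 h1, Finset.sum_congr rfl (g := fun _ => ν.real (Set.Iio x) ^ m)]
    · simp
    · intro i hi
      rw [← pow_add, Nat.add_sub_cancel' (by simpa [Nat.lt_succ_iff] using hi)]
  · refine mul_right_cancel₀ h0 ?_
    have h := measureReal_singleton_mul_interimPayoff (m := m) (ν := ν) x
    have hg := (Commute.all (ν.real (Set.Iic x)) (ν.real (Set.Iio x))).geom_sum₂_mul (m + 1)
    rw [← hg] at h
    have : ν.real {x} = ν.real (Set.Iic x) - ν.real (Set.Iio x) := by rw [hcd]; ring
    simp only [Nat.add_sub_cancel] at h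
    rw [← this] at h
    linarith

end

/-! ### Admissible atom weights -/

section

variable {n : ℕ} {μ a : ℝ}

/-- The positive solutions of `a = μ - μ * (1 - a) ^ n` are those of
`μ * ∑ i < n, (1 - a) ^ i = 1`. -/
lemma isAtomWeight_iff (hn : 0 < n) :
    IsAtomWeight n μ a ↔ 0 ≤ a ∧ a ≤ 1 ∧
      (a = 0 ∧ n * μ ≤ 1 ∨ 0 < a ∧ μ * ∑ i ∈ Finset.range n, (1 - a) ^ i = 1) := by
  have hg := mul_neg_geom_sum (1 - a) n
  have hn' : (0 : ℝ) < n := by exact_mod_cast hn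
  rw [sub_sub_cancel] at hg
  unfold IsAtomWeight
  rw [div_lt_iff₀' hn']
  refine and_congr_right fun h0 => and_congr_right fun _ => ?_
  rcases h0.eq_or_lt with rfl | h0
  · simp
  · simp only [h0, h0.ne', false_and, true_and, false_or, implies_true, and_true]
    constructor
    · intro h
      refine mul_left_cancel₀ h0.ne' ?_
      linear_combination μ * hg - h
    · intro h
      linear_combination (-a) * h + μ * hg

lemma IsAtomWeight.mul_sum_le (hn : 0 < n) (h : IsAtomWeight n μ a) :
    μ * ∑ i ∈ Finset.range n, (1 - a) ^ i ≤ 1 := by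
  obtain ⟨_, _, ⟨rfl, h1⟩ | ⟨_, h1⟩⟩ := (isAtomWeight_iff hn).1 h
  · simpa [mul_comm] using h1
  · exact h1.le

lemma sum_pow_lt_sum_pow {b c : ℝ} (hb : 0 ≤ b) (hbc : b < c) (hn : 2 ≤ n) :
    ∑ i ∈ Finset.range n, b ^ i < ∑ i ∈ Finset.range n, c ^ i :=
  Finset.sum_lt_sum (fun i _ => pow_le_pow_left₀ hb hbc.le i)
    ⟨1, Finset.mem_range.2 hn, by simpa using hbc⟩

/-- Uniqueness holds for every `μ > 0`; for `μ < 1 / n` the only admissible weight is `0`. -/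
lemma IsAtomWeight.unique (hn : 2 ≤ n) (hμ : 0 < μ) {a' : ℝ}
    (h : IsAtomWeight n μ a) (h' : IsAtomWeight n μ a') : a = a' := by
  wlog hlt : a < a' generalizing a a'
  · rcases (not_lt.1 hlt).eq_or_lt with he | hlt
    · exact he.symm
    · exact (this h' h hlt).symm
  exfalso
  have h1 := h.mul_sum_le (by omega)
  obtain ⟨h0, _, _⟩ := h
  obtain ⟨_, h1', ⟨h2, _⟩ | ⟨_, h2⟩⟩ := (isAtomWeight_iff (by omega)).1 h'
  · linarith
  · have := sum_pow_lt_sum_pow (sub_nonneg.2 h1') (sub_lt_sub_left hlt 1) hn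
    nlinarith

lemma exists_isAtomWeight (hn : 2 ≤ n) (hμ1 : μ ≤ 1) : ∃ a, IsAtomWeight n μ a := by
  have hn0 : 0 < n := by omega
  simp only [isAtomWeight_iff hn0]
  rcases le_or_gt (n * μ) 1 with h | h
  · exact ⟨0, le_rfl, zero_le_one, Or.inl ⟨rfl, h⟩⟩
  · have hc : ContinuousOn (fun a : ℝ => μ * ∑ i ∈ Finset.range n, (1 - a) ^ i) (Set.Icc 0 1) := by
      fun_prop
    obtain ⟨a, ha, ha1⟩ := intermediate_value_Icc' zero_le_one hc
      (show (1 : ℝ) ∈ _ by simp [zero_pow_eq, hn0, hμ1]; linarith)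
    refine ⟨a, ha.1, ha.2, Or.inr ⟨ha.1.lt_of_ne ?_, ha1⟩⟩
    rintro rfl
    simp at ha1
    linarith

/-- The scale `s = n * μ * (1 - a) ^ (n - 1)` is below `1` when there is an atom at `1`, because
the last of the `n` summands of `∑ i < n, (1 - a) ^ i = 1 / μ` is the smallest, and is less than
the first. -/
lemma IsAtomWeight.scale_lt_one (hn : 2 ≤ n) (hμ : 0 < μ) (h : IsAtomWeight n μ a) (ha : 0 < a) :
    n * μ * (1 - a) ^ (n - 1) < 1 := by
  have h1 := h.mul_sum_le (by omega)
  have hlt : ∑ i ∈ Finset.range n, (1 - a) ^ (n - 1) < ∑ i ∈ Finset.range n, (1 - a) ^ i := by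
    have h0 : 0 ≤ 1 - a := sub_nonneg.2 h.2.1
    refine Finset.sum_lt_sum (fun i hi => pow_le_pow_of_le_one h0 (by linarith) ?_)
      ⟨0, Finset.mem_range.2 (by omega), ?_⟩
    · have := Finset.mem_range.1 hi
      omega
    · rw [pow_zero]
      exact pow_lt_one₀ h0 (by linarith) (by omega)
  simp only [Finset.sum_const, Finset.card_range, nsmul_eq_mul] at hlt
  nlinarith

lemma IsAtomWeight.scale_le_one (hn : 2 ≤ n) (hμ : 0 < μ) (h : IsAtomWeight n μ a) :
    n * μ * (1 - a) ^ (n - 1) ≤ 1 := by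
  rcases h.1.eq_or_lt with rfl | ha
  · simpa [mul_comm] using h.mul_sum_le (by omega)
  · exact (h.scale_lt_one hn hμ ha).le

end

/-! ### Equilibria in terms of the interim payoff -/

section

variable {m : ℕ} {μ : ℝ}

/-- An equilibrium is a feasible distribution against which no feasible deviation wins with
probability more than `1 / (m + 1)`. -/
lemma isSymmetricEquilibrium_iff {F : ProbabilityMeasure ℝ} :
    IsSymmetricEquilibrium (m + 1) μ F ↔ F ∈ strategySet μ ∧
      ∀ G ∈ strategySet μ, ∫ x, interimPayoff m (F : Measure ℝ) x ∂(G : Measure ℝ) ≤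
        1 / (m + 1) := by
  have hself : ∀ i : Fin (m + 1), payoff (fun _ => F) i = 1 / (m + 1) := fun i => by
    rw [payoff_eq_integral_interimPayoff _ F i fun _ => rfl, integral_interimPayoff_self]
  have hdev : ∀ (i : Fin (m + 1)) (G : ProbabilityMeasure ℝ),
      payoff (Function.update (fun _ => F) i G) i =
        ∫ x, interimPayoff m (F : Measure ℝ) x ∂(G : Measure ℝ) := fun i G => by
    rw [payoff_eq_integral_interimPayoff _ F i (fun j => by simp [Fin.succAbove_ne]),
      Function.update_self]
  simp only [IsSymmetricEquilibrium, IsEquilibrium, hself, hdev, forall_const]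

section

variable {ν : Measure ℝ} [IsProbabilityMeasure ν]

lemma measureReal_Iic_one (hν : ν (Set.Icc 0 1)ᶜ = 0) : ν.real (Set.Iic 1) = 1 := by
  have h : ν (Set.Iic (1 : ℝ))ᶜ = 0 :=
    measure_mono_null (Set.compl_subset_compl.2 Set.Icc_subset_Iic_self) hν
  rw [measureReal_def, (prob_compl_eq_zero_iff measurableSet_Iic).1 h, ENNReal.toReal_one]

lemma measureReal_Iio_one (hν : ν (Set.Icc 0 1)ᶜ = 0) :
    ν.real (Set.Iio 1) = 1 - ν.real {1} := by
  have := measureReal_Iic_eq_add (ν := ν) 1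
  rw [measureReal_Iic_one hν] at this
  linarith

lemma interimPayoff_one (hν : ν (Set.Icc 0 1)ᶜ = 0) :
    (m + 1) * interimPayoff m ν 1 = ∑ i ∈ Finset.range (m + 1), (1 - ν.real {1}) ^ i := by
  rw [interimPayoff_eq, measureReal_Iic_one hν, measureReal_Iio_one hν]
  simpa using Finset.sum_range_reflect (fun i => (1 - ν.real {1}) ^ i) (m + 1)

end

lemma ae_mem_Icc_of_compl {ν : Measure ℝ} (hν : ν (Set.Icc 0 1)ᶜ = 0) :
    ∀ᵐ x ∂ν, x ∈ Set.Icc (0 : ℝ) 1 := by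
  rwa [ae_iff, ← Set.compl_def]

lemma integrable_id_of_mem_Icc {ν : Measure ℝ} [IsFiniteMeasure ν] (hν : ν (Set.Icc 0 1)ᶜ = 0) :
    Integrable (fun x : ℝ => x) ν := by
  refine Integrable.of_bound measurable_id.aestronglyMeasurable 1 ?_
  filter_upwards [ae_mem_Icc_of_compl hν] with x hx
  rw [Real.norm_eq_abs, abs_of_nonneg hx.1]
  exact hx.2

/-- If the interim payoff lies below the line of slope `1 / ((m + 1) * μ)` through the origin, the
mean constraint caps every deviation at `1 / (m + 1)`. -/
lemma isSymmetricEquilibrium_of_interimPayoff_le {F : ProbabilityMeasure ℝ} (hμ : 0 < μ)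
    (hF : F ∈ strategySet μ)
    (h : ∀ x ∈ Set.Icc (0 : ℝ) 1, (m + 1) * μ * interimPayoff m (F : Measure ℝ) x ≤ x) :
    IsSymmetricEquilibrium (m + 1) μ F := by
  refine isSymmetricEquilibrium_iff.2 ⟨hF, fun G hG => ?_⟩
  have hle : ∫ x, (m + 1) * μ * interimPayoff m (F : Measure ℝ) x ∂(G : Measure ℝ) ≤
      ∫ x, x ∂(G : Measure ℝ) := by
    refine integral_mono_ae ((integrable_interimPayoff _).const_mul _)
      (integrable_id_of_mem_Icc hG.1) ?_
    filter_upwards [ae_mem_Icc_of_compl hG.1] with x hx using h x hx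
  rw [integral_const_mul, hG.2] at hle
  rw [le_div_iff₀ (by positivity)]
  nlinarith

end

/-! ### The equilibrium distribution -/

section

variable {m : ℕ} {μ a s : ℝ}

/-- The mixture of weight `1 - a` on the law of `s * U ^ m`, where `U` is uniform on `[0,1]`, and of
weight `a` on the point mass at `1`. -/
noncomputable def powerAtomMeasure (m : ℕ) (a s : ℝ) : Measure ℝ :=
  ENNReal.ofReal (1 - a) • (volume.restrict (Set.Icc 0 1)).map (fun t : ℝ => s * t ^ m) +
    ENNReal.ofReal a • Measure.dirac 1

lemma powerAtomMeasure_apply (a s : ℝ) {A : Set ℝ} (hA : MeasurableSet A) :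
    powerAtomMeasure m a s A = ENNReal.ofReal (1 - a) *
      volume ({t : ℝ | s * t ^ m ∈ A} ∩ Set.Icc 0 1) + ENNReal.ofReal a * A.indicator 1 1 := by
  have hf : Measurable fun t : ℝ => s * t ^ m := by fun_prop
  simp only [powerAtomMeasure, Measure.add_apply, Measure.smul_apply, smul_eq_mul,
    Measure.map_apply hf hA, Measure.restrict_apply (hf hA), Measure.dirac_apply' _ hA]
  rfl

lemma isProbabilityMeasure_powerAtomMeasure (s : ℝ) (ha0 : 0 ≤ a) (ha1 : a ≤ 1) :
    IsProbabilityMeasure (powerAtomMeasure m a s) where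
  measure_univ := by
    rw [powerAtomMeasure_apply a s MeasurableSet.univ]
    simp [← ENNReal.ofReal_add (sub_nonneg.2 ha1) ha0]

lemma powerAtomMeasure_compl (hs : 0 ≤ s) :
    powerAtomMeasure m a s (Set.Icc 0 s ∪ {1})ᶜ = 0 := by
  rw [powerAtomMeasure_apply a s (measurableSet_Icc.union (measurableSet_singleton 1)).compl]
  have : {t : ℝ | s * t ^ m ∈ (Set.Icc 0 s ∪ {1})ᶜ} ∩ Set.Icc 0 1 = ∅ := by
    ext t
    simp only [Set.mem_inter_iff, Set.mem_empty_iff_false, iff_false, not_and]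
    rintro ht ⟨h0, h1⟩
    exact ht (Or.inl ⟨by positivity, mul_le_of_le_one_right hs (pow_le_one₀ h0 h1)⟩)
  rw [this]
  simp

lemma powerAtomMeasure_singleton_one (hm : m ≠ 0) (ha0 : 0 ≤ a) (hs1 : s ≤ 1) :
    (powerAtomMeasure m a s).real {1} = a := by
  have h0 : volume ({t : ℝ | s * t ^ m ∈ ({1} : Set ℝ)} ∩ Set.Icc 0 1) = 0 := by
    refine measure_mono_null ?_ (Real.volume_singleton (a := 1))
    rintro t ⟨ht, h0, h1⟩
    have h2 : t ^ m ≤ t := pow_le_of_le_one h0 h1 hm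
    have h3 : s * t ^ m ≤ t ^ m := mul_le_of_le_one_left (by positivity) hs1
    have h4 : s * t ^ m = 1 := ht
    exact le_antisymm h1 (by linarith)
  rw [measureReal_def, powerAtomMeasure_apply a s (measurableSet_singleton 1), h0]
  simp [ha0]

lemma powerAtomMeasure_Iic (hm : m ≠ 0) (ha1 : a ≤ 1) (hs : 0 < s) {x : ℝ} (hx0 : 0 ≤ x)
    (hxs : x ≤ s) (hx1 : x < 1) :
    (powerAtomMeasure m a s).real (Set.Iic x) = (1 - a) * (x / s) ^ (1 / (m : ℝ)) := by
  have hr0 : 0 ≤ x / s := by positivity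
  have hset : {t : ℝ | s * t ^ m ∈ Set.Iic x} ∩ Set.Icc 0 1 =
      Set.Icc 0 ((x / s) ^ (1 / (m : ℝ))) := by
    have hpow : ((x / s) ^ (1 / (m : ℝ))) ^ m = x / s := by
      rw [one_div, Real.rpow_inv_natCast_pow hr0 hm]
    have hle : (x / s) ^ (1 / (m : ℝ)) ≤ 1 :=
      Real.rpow_le_one hr0 ((div_le_one hs).2 hxs) (by positivity)
    have hiff : ∀ t : ℝ, 0 ≤ t → (s * t ^ m ≤ x ↔ t ≤ (x / s) ^ (1 / (m : ℝ))) := fun t ht => by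
      rw [← pow_le_pow_iff_left₀ ht (by positivity) hm, hpow, le_div_iff₀' hs]
    ext t
    constructor
    · rintro ⟨h, h0, h1⟩
      exact ⟨h0, (hiff t h0).1 h⟩
    · rintro ⟨h0, h⟩
      exact ⟨(hiff t h0).2 h, h0, h.trans hle⟩
  rw [measureReal_def, powerAtomMeasure_apply a s measurableSet_Iic, hset,
    Set.indicator_of_notMem (by simpa using hx1), Real.volume_Icc]
  simp [ENNReal.toReal_ofReal (sub_nonneg.2 ha1), hr0, Real.rpow_nonneg]

lemma integral_powerAtomMeasure (ha0 : 0 ≤ a) (ha1 : a ≤ 1) :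
    ∫ x, x ∂powerAtomMeasure m a s = (1 - a) * (s / (m + 1)) + a := by
  have hf : Measurable fun t : ℝ => s * t ^ m := by fun_prop
  have hi : IntegrableOn (fun t : ℝ => s * t ^ m) (Set.Icc 0 1) :=
    Continuous.integrableOn_Icc (by fun_prop)
  have h01 : ∫ t in Set.Icc (0 : ℝ) 1, s * t ^ m = s / (m + 1) := by
    rw [integral_Icc_eq_integral_Ioc, ← intervalIntegral.integral_of_le zero_le_one,
      intervalIntegral.integral_const_mul, integral_pow]
    simp [div_eq_mul_inv]
  unfold powerAtomMeasure
  rw [integral_add_measure, integral_smul_measure, integral_smul_measure, integral_dirac,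
    integral_map hf.aemeasurable (by fun_prop), h01, ENNReal.toReal_ofReal ha0,
    ENNReal.toReal_ofReal (sub_nonneg.2 ha1)]
  · simp
  · refine Integrable.smul_measure ?_ ENNReal.ofReal_ne_top
    exact (integrable_map_measure (by fun_prop) hf.aemeasurable).2 hi
  · exact (integrable_dirac (by simp)).smul_measure ENNReal.ofReal_ne_top

lemma isSymmetricEquilibrium_powerAtomMeasure (hm : m ≠ 0) (hμ : 0 < μ)
    (ha : IsAtomWeight (m + 1) μ a) (hs : s = (m + 1) * μ * (1 - a) ^ m) {F : ProbabilityMeasure ℝ}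
    (hF : (F : Measure ℝ) = powerAtomMeasure m a s) : IsSymmetricEquilibrium (m + 1) μ F := by
  have ha1 : 0 ≤ 1 - a := sub_nonneg.2 ha.2.1
  have hs0 : 0 ≤ s := by rw [hs]; positivity
  have hs1 : s ≤ 1 := by simpa [hs] using ha.scale_le_one (by omega) hμ
  have hsupp : (F : Measure ℝ) (Set.Icc 0 1)ᶜ = 0 := by
    rw [hF]
    refine measure_mono_null (Set.compl_subset_compl.2 ?_) (powerAtomMeasure_compl hs0)
    exact Set.union_subset (Set.Icc_subset_Icc_right hs1) (by simp)
  have hone : (F : Measure ℝ).real {1} = a := by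
    rw [hF, powerAtomMeasure_singleton_one hm ha.1 hs1]
  refine isSymmetricEquilibrium_of_interimPayoff_le hμ ⟨hsupp, ?_⟩ ?_
  · rw [hF, integral_powerAtomMeasure ha.1 ha.2.1, hs]
    have := ha.2.2.1
    rw [pow_succ] at this
    field_simp
    linarith
  · rintro x ⟨hx0, hx1⟩
    rcases hx1.eq_or_lt with rfl | hx1
    · have h1 := interimPayoff_one (m := m) hsupp
      have h2 := ha.mul_sum_le (by omega)
      rw [hone] at h1
      rw [← h1] at h2
      linarith
    have hle := interimPayoff_le_pow_measureReal_Iic (m := m) (ν := (F : Measure ℝ)) x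
    refine (mul_le_mul_of_nonneg_left hle (by positivity)).trans ?_
    rcases le_or_gt s x with hsx | hsx
    · have h1 : (F : Measure ℝ).real (Set.Iic x) ≤ 1 - a := by
        rw [← hone, ← measureReal_Iio_one hsupp]
        exact measureReal_mono (Set.Iic_subset_Iio.2 hx1)
      refine le_trans ?_ hsx
      rw [hs]
      gcongr
    · have hspos : 0 < s := hx0.trans_lt hsx
      rw [hF, powerAtomMeasure_Iic hm ha.2.1 hspos hx0 hsx.le hx1, mul_pow, ← mul_assoc, ← hs,
        one_div, Real.rpow_inv_natCast_pow (by positivity) hm]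
      exact (mul_div_cancel₀ _ hspos.ne').le

end

/-! ### The supporting line of an equilibrium -/

section

variable {m : ℕ} {μ : ℝ}

/-- If no two-point distribution on `[0,1]` with mean `μ` gives `H` an expectation above `v`, then
some line with value `v` at `μ` lies above `H` on `[0,1]`. No regularity of `H` is needed, as `μ` is
interior. -/
lemma exists_supporting_line {H : ℝ → ℝ} {v : ℝ} (hμ0 : 0 < μ) (hμ1 : μ < 1)
    (h : ∀ x ∈ Set.Icc (0 : ℝ) 1, ∀ y ∈ Set.Icc (0 : ℝ) 1, ∀ t ∈ Set.Icc (0 : ℝ) 1,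
      (1 - t) * x + t * y = μ → (1 - t) * H x + t * H y ≤ v) :
    ∃ α β : ℝ, α + β * μ = v ∧ ∀ x ∈ Set.Icc (0 : ℝ) 1, H x ≤ α + β * x := by
  have key : ∀ x ∈ Set.Ico 0 μ, ∀ y ∈ Set.Ioc μ 1, (H y - v) / (y - μ) ≤ (v - H x) / (μ - x) := by
    rintro x ⟨hx0, hx⟩ y ⟨hy, hy1⟩
    have hyx : 0 < y - x := by linarith
    have h1 := h x ⟨hx0, by linarith⟩ y ⟨by linarith, hy1⟩ ((μ - x) / (y - x))
      ⟨div_nonneg (by linarith) hyx.le, (div_le_one hyx).2 (by linarith)⟩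
      (by field_simp; ring)
    have h2 : 1 - (μ - x) / (y - x) = (y - μ) / (y - x) := by field_simp; ring
    rw [h2, div_mul_eq_mul_div, div_mul_eq_mul_div, ← add_div, div_le_iff₀ hyx] at h1
    rw [div_le_div_iff₀ (by linarith) (by linarith)]
    linarith
  set S := (fun y => (H y - v) / (y - μ)) '' Set.Ioc μ 1 with hS
  have hne : S.Nonempty := ⟨_, 1, ⟨hμ1, le_rfl⟩, rfl⟩
  have hbd : BddAbove S := by
    refine ⟨(v - H 0) / (μ - 0), ?_⟩
    rintro _ ⟨y, hy, rfl⟩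
    exact key 0 ⟨le_rfl, hμ0⟩ y hy
  -- `S` holds the slopes of the chords to the right of `μ`; `key` bounds them by those to the left
  refine ⟨v - sSup S * μ, sSup S, by ring, fun x hx => ?_⟩
  rcases lt_trichotomy x μ with hlt | rfl | hlt
  · have h1 : sSup S ≤ (v - H x) / (μ - x) := by
      refine csSup_le hne ?_
      rintro _ ⟨y, hy, rfl⟩
      exact key x ⟨hx.1, hlt⟩ y hy
    rw [le_div_iff₀ (by linarith)] at h1
    linarith
  · have h1 := h x hx x hx 0 ⟨le_rfl, zero_le_one⟩ (by ring)
    linarith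
  · have h1 : (H x - v) / (x - μ) ≤ sSup S := le_csSup hbd ⟨x, ⟨hlt, hx.2⟩, rfl⟩
    rw [div_le_iff₀ (by linarith)] at h1
    linarith

lemma two_point_deviation_le {F : ProbabilityMeasure ℝ} (hF : IsSymmetricEquilibrium (m + 1) μ F)
    {x y t : ℝ} (hx : x ∈ Set.Icc (0 : ℝ) 1) (hy : y ∈ Set.Icc (0 : ℝ) 1)
    (ht : t ∈ Set.Icc (0 : ℝ) 1) (hxy : (1 - t) * x + t * y = μ) :
    (1 - t) * interimPayoff m (F : Measure ℝ) x + t * interimPayoff m (F : Measure ℝ) y ≤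
      1 / (m + 1) := by
  have h1t : 0 ≤ 1 - t := sub_nonneg.2 ht.2
  let P : Measure ℝ :=
    ENNReal.ofReal (1 - t) • Measure.dirac x + ENNReal.ofReal t • Measure.dirac y
  have hP : IsProbabilityMeasure P :=
    ⟨by simp [P, ← ENNReal.ofReal_add h1t ht.1]⟩
  have hint : ∀ g : ℝ → ℝ, ∫ r, g r ∂P = (1 - t) * g x + t * g y := by
    intro g
    rw [integral_add_measure, integral_smul_measure, integral_smul_measure, integral_dirac,
      integral_dirac, ENNReal.toReal_ofReal h1t, ENNReal.toReal_ofReal ht.1]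
    · rfl
    · exact (integrable_dirac (by simp)).smul_measure ENNReal.ofReal_ne_top
    · exact (integrable_dirac (by simp)).smul_measure ENNReal.ofReal_ne_top
  have hmem : (⟨P, hP⟩ : ProbabilityMeasure ℝ) ∈ strategySet μ := by
    refine ⟨?_, (hint fun r => r).trans hxy⟩
    simp only [ProbabilityMeasure.coe_mk, P, Measure.add_apply, Measure.smul_apply,
      Measure.dirac_apply' _ measurableSet_Icc.compl]
    simp [hx.1, hx.2, hy.1, hy.2]
  have := (isSymmetricEquilibrium_iff.1 hF).2 _ hmem
  rwa [ProbabilityMeasure.coe_mk, hint] at this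

lemma exists_line_of_isSymmetricEquilibrium {F : ProbabilityMeasure ℝ} (hμ0 : 0 < μ) (hμ1 : μ < 1)
    (hF : IsSymmetricEquilibrium (m + 1) μ F) :
    ∃ α β : ℝ, α + β * μ = 1 / (m + 1) ∧
      (∀ x ∈ Set.Icc (0 : ℝ) 1, interimPayoff m (F : Measure ℝ) x ≤ α + β * x) ∧
      ∀ᵐ x ∂(F : Measure ℝ), interimPayoff m (F : Measure ℝ) x = α + β * x := by
  obtain ⟨hsupp, hmean⟩ := (isSymmetricEquilibrium_iff.1 hF).1
  obtain ⟨α, β, hv, hle⟩ := exists_supporting_line hμ0 hμ1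
    fun x hx y hy t ht h => two_point_deviation_le hF hx hy ht h
  refine ⟨α, β, hv, hle, ?_⟩
  have hlin : Integrable (fun x : ℝ => α + β * x) (F : Measure ℝ) :=
    (integrable_const α).add ((integrable_id_of_mem_Icc hsupp).const_mul β)
  have hnn : 0 ≤ᵐ[(F : Measure ℝ)] fun x => α + β * x - interimPayoff m (F : Measure ℝ) x := by
    filter_upwards [ae_mem_Icc_of_compl hsupp] with x hx using sub_nonneg.2 (hle x hx)
  have hzero : ∫ x, (α + β * x - interimPayoff m (F : Measure ℝ) x) ∂(F : Measure ℝ) = 0 := by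
    rw [integral_sub hlin (integrable_interimPayoff _), integral_interimPayoff_self,
      integral_add (integrable_const α) ((integrable_id_of_mem_Icc hsupp).const_mul β),
      integral_const_mul, hmean]
    simp [hv]
  have := (integral_eq_zero_iff_of_nonneg_ae hnn (hlin.sub (integrable_interimPayoff _))).1 hzero
  filter_upwards [this] with x hx
  have hx' : α + β * x - interimPayoff m (F : Measure ℝ) x = 0 := hx
  linarith

end

/-! ### Distributions whose payoff lies on a line almost everywhere -/

section

variable {m : ℕ} {ν : Measure ℝ} [IsProbabilityMeasure ν] {α β : ℝ}

/-- Sharing a tie costs: at an atom the interim payoff is below its right limit. -/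
lemma interimPayoff_lt_of_atom (hm : m ≠ 0) {x : ℝ} (hx : ν.real {x} ≠ 0) :
    interimPayoff m ν x < ν.real (Set.Iic x) ^ m := by
  have hlt : ν.real (Set.Iio x) < ν.real (Set.Iic x) := by
    rw [measureReal_Iic_eq_add]
    exact lt_add_of_pos_right _ (measureReal_nonneg.lt_of_ne' hx)
  have h0 : 0 ≤ ν.real (Set.Iio x) := measureReal_nonneg
  have hsum : ∑ i ∈ Finset.range (m + 1), ν.real (Set.Iic x) ^ i * ν.real (Set.Iio x) ^ (m - i) <
      ∑ i ∈ Finset.range (m + 1), ν.real (Set.Iic x) ^ m := by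
    refine Finset.sum_lt_sum (fun i hi => ?_) ⟨0, by simp, ?_⟩
    · rw [← pow_mul_pow_sub (ν.real (Set.Iic x)) (Nat.lt_succ_iff.1 (Finset.mem_range.1 hi))]
      gcongr
    · simpa using pow_lt_pow_left₀ hlt h0 hm
  rw [← interimPayoff_eq] at hsum
  simp only [Finset.sum_const, Finset.card_range, nsmul_eq_mul, Nat.cast_add, Nat.cast_one] at hsum
  exact lt_of_mul_lt_mul_left hsum (by positivity)

/-- A distribution whose interim payoff lies below a line, and on it almost everywhere, has no atom
in `[0,1)`: moving slightly to the right of the atom would win all ties and cross the line. -/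
lemma measureReal_singleton_eq_zero_of_le_line (hm : m ≠ 0)
    (hle : ∀ x ∈ Set.Icc (0 : ℝ) 1, interimPayoff m ν x ≤ α + β * x)
    (heq : ∀ᵐ x ∂ν, interimPayoff m ν x = α + β * x) {x : ℝ} (hx : x ∈ Set.Ico (0 : ℝ) 1) :
    ν.real {x} = 0 := by
  by_contra hne
  have hx' : interimPayoff m ν x = α + β * x := by
    by_contra h
    refine hne ?_
    rw [measureReal_def, measure_mono_null (Set.singleton_subset_iff.2 h) heq,
      ENNReal.toReal_zero]
  -- to the right of `x` the payoff is at least `c x ^ m`, and the line is continuous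
  have hlim : ν.real (Set.Iic x) ^ m ≤ α + β * x := by
    have ht : Filter.Tendsto (fun y : ℝ => α + β * y) (nhdsWithin x (Set.Ioi x))
        (nhds (α + β * x)) :=
      (Continuous.tendsto (by fun_prop) x).mono_left nhdsWithin_le_nhds
    refine ge_of_tendsto ht ?_
    filter_upwards [Ioc_mem_nhdsGT hx.2] with y hy
    calc ν.real (Set.Iic x) ^ m ≤ ν.real (Set.Iio y) ^ m :=
          pow_le_pow_left₀ measureReal_nonneg (measureReal_mono (Set.Iic_subset_Iio.2 hy.1)) m
      _ ≤ interimPayoff m ν y := pow_measureReal_Iio_le_interimPayoff y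
      _ ≤ α + β * y := hle y ⟨hx.1.trans hy.1.le, hy.2⟩
  have := interimPayoff_lt_of_atom hm hne
  linarith

lemma interimPayoff_eq_pow_of_no_atom {x : ℝ} (hx : ν.real {x} = 0) :
    interimPayoff m ν x = ν.real (Set.Iic x) ^ m := by
  refine le_antisymm (interimPayoff_le_pow_measureReal_Iic x) ?_
  rw [measureReal_Iic_eq_add, hx, add_zero]
  exact pow_measureReal_Iio_le_interimPayoff x

/-- If some mass lies in `(x, 1)`, then the line takes the value `ν (-∞, x] ^ m` at a point `y ≥ x`,
namely at the infimum of the points beyond `x` where payoff and line agree: `ν` puts no mass between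
`x` and `y`. Negative `x` are allowed. -/
lemma exists_touching_point (hm : m ≠ 0) (hν : ν (Set.Icc 0 1)ᶜ = 0)
    (hle : ∀ x ∈ Set.Icc (0 : ℝ) 1, interimPayoff m ν x ≤ α + β * x)
    (heq : ∀ᵐ x ∂ν, interimPayoff m ν x = α + β * x) {x : ℝ}
    (hx : ν.real (Set.Iic x) < ν.real (Set.Iio 1)) :
    ∃ y ∈ Set.Ico (0 : ℝ) 1, x ≤ y ∧ ν.real (Set.Iic x) ^ m = α + β * y := by
  have hatom : ∀ y ∈ Set.Ico (0 : ℝ) 1, ν.real {y} = 0 := fun y hy =>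
    measureReal_singleton_eq_zero_of_le_line hm hle heq hy
  -- `E` is where payoff and line agree, and `T` its part beyond `x`; the claimed point is `sInf T`
  let E : Set ℝ := {y | y ∈ Set.Icc (0 : ℝ) 1 ∧ interimPayoff m ν y = α + β * y}
  have hE : ν Eᶜ = 0 := by
    have : ∀ᵐ y ∂ν, y ∈ E := by
      filter_upwards [ae_mem_Icc_of_compl hν, heq] with y h1 h2 using ⟨h1, h2⟩
    exact this
  let T : Set ℝ := E ∩ Set.Ioo x 1
  have hx1 : x < 1 := by
    by_contra h
    exact hx.not_ge (measureReal_mono fun y (hy : y < 1) => (hy.trans_le (not_lt.1 h)).le)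
  have hT : T.Nonempty := by
    by_contra h
    rw [Set.not_nonempty_iff_eq_empty] at h
    have h0 : ν (Set.Ioo x 1) = 0 :=
      measure_mono_null (fun y hy hyE => h.subset (show y ∈ T from ⟨hyE, hy⟩)) hE
    have hu : ν.real (Set.Iio 1) ≤ ν.real (Set.Iic x) + ν.real (Set.Ioo x 1) := by
      rw [← Set.Iic_union_Ioo_eq_Iio hx1]
      exact measureReal_union_le _ _
    rw [measureReal_def (s := Set.Ioo x 1), h0] at hu
    simp at hu
    linarith
  have hTb : BddBelow T := ⟨x, fun y hy => hy.2.1.le⟩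
  obtain ⟨w, -, hwt, hwT⟩ := exists_seq_tendsto_sInf hT hTb
  set y := sInf T with hy
  have hxy : x ≤ y := le_csInf hT fun z hz => hz.2.1.le
  have hy0 : 0 ≤ y := le_csInf hT fun z hz => hz.1.1.1
  have hy1 : y < 1 := by
    obtain ⟨z, hz⟩ := hT
    exact (csInf_le hTb hz).trans_lt hz.2.2
  refine ⟨y, ⟨hy0, hy1⟩, hxy, ?_⟩
  -- no mass lies between `x` and `y`, so the distribution functions at `x` and `y` agree
  have hcxy : ν.real (Set.Iic x) = ν.real (Set.Iic y) := by
    refine le_antisymm (measureReal_mono (Set.Iic_subset_Iic.2 hxy)) ?_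
    have h0 : ν (Set.Ioo x y) = 0 :=
      measure_mono_null (fun z hz hzE =>
        (csInf_le hTb (show z ∈ T from ⟨hzE, hz.1, hz.2.trans hy1⟩)).not_gt hz.2) hE
    have hsub : Set.Iic y ⊆ (Set.Iic x ∪ Set.Ioo x y) ∪ {y} := by
      intro z hz
      rcases (show z ≤ y from hz).eq_or_lt with rfl | h
      · exact Or.inr rfl
      · rcases le_or_gt z x with h' | h'
        · exact Or.inl (Or.inl h')
        · exact Or.inl (Or.inr ⟨h', h⟩)
    have h1 := measureReal_mono (μ := ν) hsub
    have h2 := measureReal_union_le (μ := ν) (Set.Iic x ∪ Set.Ioo x y) {y}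
    have h3 := measureReal_union_le (μ := ν) (Set.Iic x) (Set.Ioo x y)
    rw [measureReal_def (s := Set.Ioo x y), h0, ENNReal.toReal_zero] at h3
    rw [hatom y ⟨hy0, hy1⟩] at h2
    linarith
  rw [hcxy]
  have hwy : ∀ k, y ≤ w k := fun k => csInf_le hTb (hwT k)
  have hcont : Filter.Tendsto (fun k => ν.real (Set.Iic (w k))) Filter.atTop
      (nhds (ν.real (Set.Iic y))) := by
    simp only [← ProbabilityTheory.cdf_eq_real]
    exact ((ProbabilityTheory.cdf ν).right_continuous y).tendsto.comp
      (tendsto_nhdsWithin_iff.2 ⟨hwt, Filter.Eventually.of_forall hwy⟩)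
  refine tendsto_nhds_unique (hcont.pow m) ?_
  have hlin : Filter.Tendsto (fun k => α + β * w k) Filter.atTop (nhds (α + β * y)) :=
    (hwt.const_mul β).const_add α
  refine hlin.congr fun k => ?_
  rw [← (hwT k).1.2, interimPayoff_eq_pow_of_no_atom
    (hatom _ ⟨hy0.trans (hwy k), (hwT k).2.2⟩)]

end

/-! ### Uniqueness of the equilibrium -/

section

variable {m : ℕ} {μ : ℝ}

/-- The lowest point `y` of the support of `ν` is below `1` and no atom, hence is never selected, so
the line vanishes at `y`; as it is nonnegative at `0` and at `1`, it vanishes at `0`. -/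
lemma line_through_origin (hm : m ≠ 0) {ν : Measure ℝ} [IsProbabilityMeasure ν]
    {α β : ℝ} (hν : ν (Set.Icc 0 1)ᶜ = 0) (hone : ν.real {1} < 1)
    (hle : ∀ x ∈ Set.Icc (0 : ℝ) 1, interimPayoff m ν x ≤ α + β * x)
    (heq : ∀ᵐ x ∂ν, interimPayoff m ν x = α + β * x) : α = 0 := by
  have hneg : ν.real (Set.Iic (-1)) = 0 := by
    rw [measureReal_def, measure_mono_null _ hν, ENNReal.toReal_zero]
    intro x (hx : x ≤ -1) h
    linarith [h.1]
  -- there is no mass at or below `-1`, so the touching point is where the line vanishes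
  obtain ⟨y, ⟨hy0, hy1⟩, -, hy⟩ := exists_touching_point hm hν hle heq (x := -1)
    (by rw [hneg, measureReal_Iio_one hν]; linarith)
  rw [hneg, zero_pow hm] at hy
  have h0 := (interimPayoff_nonneg 0).trans (hle 0 ⟨le_rfl, zero_le_one⟩)
  have h1 := (interimPayoff_nonneg 1).trans (hle 1 ⟨zero_le_one, le_rfl⟩)
  rcases hy0.eq_or_lt with rfl | hy0
  · linarith
  · have hβ : 0 ≤ β := by
      by_contra h
      nlinarith
    nlinarith

lemma measureReal_one_lt_one {F : ProbabilityMeasure ℝ} (hμ1 : μ < 1) (hF : F ∈ strategySet μ) :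
    (F : Measure ℝ).real {1} < 1 := by
  refine measureReal_le_one.lt_of_ne fun h => ?_
  have h1 : ∀ᵐ x ∂(F : Measure ℝ), x ∈ ({1} : Set ℝ) := by
    refine (mem_ae_iff_prob_eq_one (measurableSet_singleton 1)).2 ?_
    rwa [measureReal_def, ENNReal.toReal_eq_one_iff] at h
  have h2 := hF.2
  rw [integral_congr_ae (g := fun _ => 1) (by filter_upwards [h1] with x hx using hx)] at h2
  simp at h2
  linarith

lemma eq_dirac_of_mem_strategySet_one {F : ProbabilityMeasure ℝ} (hF : F ∈ strategySet 1) :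
    (F : Measure ℝ) = Measure.dirac 1 := by
  have hint := integrable_id_of_mem_Icc hF.1
  have hnn : 0 ≤ᵐ[(F : Measure ℝ)] fun x => 1 - x := by
    filter_upwards [ae_mem_Icc_of_compl hF.1] with x hx using sub_nonneg.2 hx.2
  have hzero : ∫ x, (1 - x) ∂(F : Measure ℝ) = 0 := by
    rw [integral_sub (integrable_const 1) hint, hF.2]
    simp
  have hae : (id : ℝ → ℝ) =ᵐ[(F : Measure ℝ)] fun _ => 1 := by
    filter_upwards [(integral_eq_zero_iff_of_nonneg_ae hnn ((integrable_const 1).sub hint)).1 hzero]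
      with x hx
    have hx' : 1 - x = 0 := hx
    rw [id]
    linarith
  rw [← Measure.map_id (μ := (F : Measure ℝ)), Measure.map_congr hae, Measure.map_const]
  simp

/-- The distribution function of an equilibrium is determined on `[0,1)` by its atom at `1`, and the
mass of this atom is an admissible weight. -/
lemma isAtomWeight_and_Iic_of_isSymmetricEquilibrium (hm : m ≠ 0) (hμ0 : 0 < μ) (hμ1 : μ < 1)
    {F : ProbabilityMeasure ℝ} (hF : IsSymmetricEquilibrium (m + 1) μ F) :
    IsAtomWeight (m + 1) μ ((F : Measure ℝ).real {1}) ∧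
      ∀ x ∈ Set.Ico (0 : ℝ) 1, (m + 1) * μ * (F : Measure ℝ).real (Set.Iic x) ^ m =
        min x ((m + 1) * μ * (1 - (F : Measure ℝ).real {1}) ^ m) := by
  have hstrat := (isSymmetricEquilibrium_iff.1 hF).1
  have hν := hstrat.1
  obtain ⟨α, β, hv, hle, heq⟩ := exists_line_of_isSymmetricEquilibrium hμ0 hμ1 hF
  obtain rfl : α = 0 := line_through_origin hm hν (measureReal_one_lt_one hμ1 hstrat)
    hle heq
  have hβ : (m + 1) * μ * β = 1 := by
    field_simp at hv
    linarith
  simp only [zero_add] at hle heq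
  have hscale : (0 : ℝ) < (m + 1) * μ := by positivity
  constructor
  · -- compare the payoff at `1` with the line: equality holds if there is an atom at `1`
    have h1 := interimPayoff_one (m := m) hν
    refine (isAtomWeight_iff (Nat.succ_pos m)).2 ⟨measureReal_nonneg, measureReal_le_one, ?_⟩
    rw [← h1]
    rcases (measureReal_nonneg (μ := (F : Measure ℝ)) (s := {1})).eq_or_lt' with ha | ha
    · refine Or.inl ⟨ha, ?_⟩
      have h2 := hle 1 ⟨zero_le_one, le_rfl⟩
      rw [ha] at h1
      simp at h1
      push_cast
      nlinarith
    · refine Or.inr ⟨ha, ?_⟩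
      have h2 : interimPayoff m (F : Measure ℝ) 1 = β * 1 := by
        by_contra h
        refine ha.ne' ?_
        rw [measureReal_def, measure_mono_null (Set.singleton_subset_iff.2 h) heq,
          ENNReal.toReal_zero]
      rw [h2]
      linarith
  · intro x hx
    have hatom := measureReal_singleton_eq_zero_of_le_line hm (α := 0) (β := β) (by simpa using hle)
      (by simpa using heq) hx
    have hb : (F : Measure ℝ).real (Set.Iic x) ≤ 1 - (F : Measure ℝ).real {1} := by
      rw [← measureReal_Iio_one hν]
      exact measureReal_mono (Set.Iic_subset_Iio.2 hx.2)
    have hlex : (F : Measure ℝ).real (Set.Iic x) ^ m ≤ β * x := by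
      rw [← interimPayoff_eq_pow_of_no_atom hatom]
      exact hle x ⟨hx.1, hx.2.le⟩
    have hlex' : (m + 1) * μ * (F : Measure ℝ).real (Set.Iic x) ^ m ≤ x := by
      calc _ ≤ (m + 1) * μ * (β * x) := by gcongr
        _ = x := by rw [← mul_assoc, hβ, one_mul]
    have hpow : (m + 1) * μ * (F : Measure ℝ).real (Set.Iic x) ^ m ≤
        (m + 1) * μ * (1 - (F : Measure ℝ).real {1}) ^ m := by gcongr
    -- either all mass of `[0,1)` is at or below `x`, or the payoff at `x` is on the line
    rcases hb.eq_or_lt with hb | hb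
    · rw [hb] at hlex' ⊢
      exact (min_eq_right hlex').symm
    · obtain ⟨y, -, hxy, hy⟩ := exists_touching_point hm hν (α := 0) (β := β) (by simpa using hle)
        (by simpa using heq) (x := x) (by rwa [measureReal_Iio_one hν])
      have : (m + 1) * μ * (F : Measure ℝ).real (Set.Iic x) ^ m = y := by
        rw [hy, zero_add, ← mul_assoc, hβ, one_mul]
      have hxy' : (m + 1) * μ * (F : Measure ℝ).real (Set.Iic x) ^ m = x := by linarith
      rw [min_eq_left (hxy' ▸ hpow)]
      exact hxy'

lemma isSymmetricEquilibrium_unique (hm : m ≠ 0) (hμ0 : 0 < μ) (hμ1 : μ ≤ 1)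
    {F G : ProbabilityMeasure ℝ} (hF : IsSymmetricEquilibrium (m + 1) μ F)
    (hG : IsSymmetricEquilibrium (m + 1) μ G) : F = G := by
  have hFs := (isSymmetricEquilibrium_iff.1 hF).1
  have hGs := (isSymmetricEquilibrium_iff.1 hG).1
  suffices h : (F : Measure ℝ) = (G : Measure ℝ) from Subtype.ext h
  rcases hμ1.eq_or_lt with rfl | hμ1
  · exact (eq_dirac_of_mem_strategySet_one hFs).trans (eq_dirac_of_mem_strategySet_one hGs).symm
  obtain ⟨haF, hcF⟩ := isAtomWeight_and_Iic_of_isSymmetricEquilibrium hm hμ0 hμ1 hF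
  obtain ⟨haG, hcG⟩ := isAtomWeight_and_Iic_of_isSymmetricEquilibrium hm hμ0 hμ1 hG
  have ha := haF.unique (by omega) hμ0 haG
  refine Measure.ext_of_Iic _ _ fun x =>
    (ENNReal.toReal_eq_toReal_iff' (measure_ne_top _ _) (measure_ne_top _ _)).1 ?_
  simp only [← measureReal_def]
  rcases lt_or_ge x 0 with hx | hx0
  · have h : ∀ {P : ProbabilityMeasure ℝ}, P ∈ strategySet μ →
        (P : Measure ℝ).real (Set.Iic x) = 0 := by
      intro P hP
      rw [measureReal_def, measure_mono_null _ hP.1, ENNReal.toReal_zero]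
      intro y (hy : y ≤ x) h
      linarith [h.1]
    exact (h hFs).trans (h hGs).symm
  rcases lt_or_ge x 1 with hx1 | hx1
  · have h1 := hcF x ⟨hx0, hx1⟩
    rw [ha, ← hcG x ⟨hx0, hx1⟩] at h1
    exact (pow_left_inj₀ measureReal_nonneg measureReal_nonneg hm).1
      (mul_left_cancel₀ (by positivity) h1)
  · have h : ∀ {P : ProbabilityMeasure ℝ}, P ∈ strategySet μ →
        (P : Measure ℝ).real (Set.Iic x) = 1 := by
      intro P hP
      refine le_antisymm measureReal_le_one ?_
      rw [← measureReal_Iic_one hP.1]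
      exact measureReal_mono (Set.Iic_subset_Iic.2 hx1)
    exact (h hFs).trans (h hGs).symm

end

/-! ### Classification of the symmetric equilibria -/

/-- Both cases of the classification at once; for `μ < 1 / (m + 1)` it is used with `a = 0`. -/
lemma exists_symmetricEquilibrium {m : ℕ} (hm : m ≠ 0) {μ a s : ℝ} (hμ0 : 0 < μ) (hμ1 : μ ≤ 1)
    (ha : IsAtomWeight (m + 1) μ a) (hs : s = (m + 1) * μ * (1 - a) ^ m) :
    s ≤ 1 ∧ ∃ F : ProbabilityMeasure ℝ,
      (∀ G : ProbabilityMeasure ℝ, IsSymmetricEquilibrium (m + 1) μ G ↔ G = F) ∧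
      (∀ x ∈ Set.Icc 0 s,
        (F : Measure ℝ).real (Set.Iic x) = (1 - a) * (x / s) ^ (1 / (m : ℝ))) ∧
      (F : Measure ℝ).real {1} = a ∧
      (F : Measure ℝ) (Set.Icc 0 s ∪ {1})ᶜ = 0 := by
  have ha1 : 0 ≤ 1 - a := sub_nonneg.2 ha.2.1
  have hs0 : 0 ≤ s := by rw [hs]; positivity
  have hs1 : s ≤ 1 := by simpa [hs] using ha.scale_le_one (by omega) hμ0
  let F : ProbabilityMeasure ℝ :=
    ⟨powerAtomMeasure m a s, isProbabilityMeasure_powerAtomMeasure s ha.1 ha.2.1⟩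
  have hF : IsSymmetricEquilibrium (m + 1) μ F :=
    isSymmetricEquilibrium_powerAtomMeasure hm hμ0 ha hs rfl
  have hsupp := (isSymmetricEquilibrium_iff.1 hF).1.1
  have hone : (F : Measure ℝ).real {1} = a := powerAtomMeasure_singleton_one hm ha.1 hs1
  refine ⟨hs1, F, fun G => ⟨fun hG => isSymmetricEquilibrium_unique hm hμ0 hμ1 hG hF,
    fun h => h ▸ hF⟩, ?_, hone, powerAtomMeasure_compl hs0⟩
  rintro x ⟨hx0, hxs⟩
  -- `s = 0` happens for `a = 1` only, and then `x / s` is a junk value multiplied by `1 - a = 0`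
  rcases hs0.eq_or_lt with rfl | hspos
  · obtain rfl : x = 0 := le_antisymm hxs hx0
    have h1a : 1 - a = 0 := by
      rw [eq_comm, mul_eq_zero] at hs
      exact pow_eq_zero_iff hm |>.1 (hs.resolve_left (by positivity))
    have h := measureReal_mono (μ := (F : Measure ℝ)) (Set.Iic_subset_Iio.2 zero_lt_one)
    rw [measureReal_Iio_one hsupp, hone, h1a] at h
    rw [h1a, zero_mul]
    exact le_antisymm h measureReal_nonneg
  rcases (hxs.trans hs1).lt_or_eq with hx1 | rfl
  · exact powerAtomMeasure_Iic hm ha.2.1 hspos hx0 hxs hx1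
  · -- the atom at `1` counts for `x = 1`, but `s = 1` leaves room for none
    obtain rfl : 1 = s := le_antisymm hxs hs1
    have : a = 0 := by
      by_contra h
      have := ha.scale_lt_one (by omega) hμ0 (ha.1.lt_of_ne' h)
      push_cast [Nat.add_sub_cancel] at this
      linarith
    rw [measureReal_Iic_one hsupp, this]
    simp

theorem theorem4 (n : ℕ) (hn : 2 ≤ n) (μ : ℝ) (hμ0 : 0 < μ) (hμ1 : μ ≤ 1) :
    (1 / (n : ℝ) ≤ μ →
      (∃! a : ℝ, IsAtomWeight n μ a) ∧
      ∀ a s : ℝ, IsAtomWeight n μ a → s = n * μ * (1 - a) ^ (n - 1) →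
        s ≤ 1 ∧
        ∃ F : ProbabilityMeasure ℝ,
          (∀ G : ProbabilityMeasure ℝ, IsSymmetricEquilibrium n μ G ↔ G = F) ∧
          (∀ x ∈ Set.Icc 0 s,
            (F : Measure ℝ).real (Set.Iic x) = (1 - a) * (x / s) ^ (1 / ((n : ℝ) - 1))) ∧
          (F : Measure ℝ).real {1} = a ∧
          (F : Measure ℝ) (Set.Icc 0 s ∪ {1})ᶜ = 0) ∧
    (μ < 1 / (n : ℝ) →
      ∃ F : ProbabilityMeasure ℝ,
        (∀ G : ProbabilityMeasure ℝ, IsSymmetricEquilibrium n μ G ↔ G = F) ∧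
        (∀ x ∈ Set.Icc 0 (n * μ),
          (F : Measure ℝ).real (Set.Iic x) = (x / (n * μ)) ^ (1 / ((n : ℝ) - 1))) ∧
        (F : Measure ℝ) (Set.Icc 0 (n * μ))ᶜ = 0) := by
  obtain ⟨m, rfl⟩ : ∃ m, n = m + 1 := ⟨n - 1, by omega⟩
  have hm : m ≠ 0 := by omega
  simp only [Nat.cast_add, Nat.cast_one, add_sub_cancel_right, Nat.add_sub_cancel]
  refine ⟨fun _ => ⟨?_, fun a s ha hs => exists_symmetricEquilibrium hm hμ0 hμ1 ha hs⟩, fun h => ?_⟩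
  · obtain ⟨a, ha⟩ := exists_isAtomWeight hn hμ1
    exact ⟨a, ha, fun a' ha' => ha'.unique hn hμ0 ha⟩
  · have hnμ : (m + 1) * μ < 1 := by rwa [lt_div_iff₀' (by positivity)] at h
    have ha : IsAtomWeight (m + 1) μ 0 :=
      (isAtomWeight_iff (by omega)).2
        ⟨le_rfl, zero_le_one, Or.inl ⟨rfl, by push_cast; exact hnμ.le⟩⟩
    obtain ⟨-, F, hF, hcdf, hone, hsupp⟩ :=
      exists_symmetricEquilibrium hm hμ0 hμ1 ha (s := (m + 1) * μ) (by simp)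
    refine ⟨F, hF, fun x hx => by rw [hcdf x hx, sub_zero, one_mul], ?_⟩
    rw [measureReal_eq_zero_iff] at hone
    refine measure_mono_null (t := (Set.Icc 0 ((m + 1) * μ) ∪ {1})ᶜ ∪ {1}) (fun x hx => ?_)
      (measure_union_null hsupp hone)
    by_cases h1 : x = 1
    · exact Or.inr h1
    · exact Or.inl fun h => h.elim hx h1
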